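/- Let $\mathfrak b,\mathfrak r,\omega_1,\omega_2>0$ and $\alpha\in\mathbb R$. Let $\varepsilon$ be the (measurable, real-valued) solution on $\mathbb R$ of the Sinh-Gordon TBA equation $$\varepsilon(\lambda)=2\mathfrak r\sin\Big[\tfrac{\pi}{1+\mathfrak b^2}\Big]\cosh\lambda+\int_{\mathbb R}K(\lambda-\mu)\ln\big[1+e^{-\varepsilon(\mu)}\big]\,d\mu,\qquad K(\lambda)=\frac{4\cosh(\lambda)\sin\big[\frac{\pi}{1+\mathfrak b^2}\big]}{\cosh(2\lambda)-\cos\big[\frac{2\pi}{1+\mathfrak b^2}\big]},$$ and put $g(\mu)=2\ln[1+e^{-\varepsilon(\mu)}]$. For integers $N\ge 2$ let $\tau_N=\ln N$, $\overline\omega_a=2\pi\tau_N\omega_a$, $$V_{N;\alpha}(\lambda)=\frac{\mathfrak r}{N\tau_N}\cosh[\tau_N\lambda]-\frac{\alpha\lambda}{N}-\int_{\mathbb R}\frac{d\mu}{2\pi N}\,\frac{g(\tau_N\mu)}{\cosh[\tau_N(\lambda-\mu)]},$$ and let the equilibrium measure $\widehat\mu_{\mathrm{eq};\alpha}$ be the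 minimiser, over all Borel probability measures $\mu$ on $\mathbb R$, of $$\mathcal E_N[\mu]=\int V_{N;\alpha}(s)\,d\mu(s)-\frac1{2\tau_N}\iint\ln\Big\{\prod_{a=1}^2\sinh\Big(\overline\omega_a\frac{s-t}2\Big)\Big\}\,d\mu(s)\,d\mu(t)\in(-\infty,+\infty],$$ where $\ln 0=-\infty$ and $\mathcal E_N[\mu]=+\infty$ if one of the integrals is not finite. Let $a_{N;\alpha}$ and $b_{N;\alpha}$ be the smallest and the largest point of the support of $\widehat\mu_{\mathrm{eq};\alpha}$ (its endpoints, when the support is a segment $[a_{N;\alpha},b_{N;\alpha}]$). Then there exist $N_0>0$ and $\varsigma>0$ such that for all $N\ge N_0$ these two points exist and satisfy $$a_{N;\alpha}\le-\varsigma\qquad\text{and}\qquad b_{N;\alpha}\ge\varsigma .$$ -/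

import Mathlib

open MeasureTheory

namespace LukyanovIntegral

noncomputable section

/-- The kernel `K` of the thermodynamic Bethe Ansatz equation of the Sinh-Gordon model with
interaction parameter `b`. -/
def tbaKernel (b x : ℝ) : ℝ :=
  4 * Real.cosh x * Real.sin (Real.pi / (1 + b ^ 2)) /
    (Real.cosh (2 * x) - Real.cos (2 * Real.pi / (1 + b ^ 2)))

/-- `ε` solves the TBA equation of the Sinh-Gordon model with parameters `b, r > 0`
(as an identity between classes of measurable functions). For `b, r > 0` the kernel is positive,
so a solution dominates the driving term `2 r sin (π / (1 + b ^ 2)) cosh x`; hence the integral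
below always converges and differs from the driving term by a bounded function. -/
structure IsTBASolution (b r : ℝ) (ε : ℝ → ℝ) : Prop where
  aemeasurable : AEMeasurable ε volume
  equation : ∀ᵐ x ∂(volume : Measure ℝ),
    ε x = 2 * r * Real.sin (Real.pi / (1 + b ^ 2)) * Real.cosh x
      + ∫ y, tbaKernel b (x - y) * Real.log (1 + Real.exp (-ε y))

/-- The function `g = 2 ln (1 + exp (-ε))`. -/
def gFun (ε : ℝ → ℝ) (y : ℝ) : ℝ := 2 * Real.log (1 + Real.exp (-ε y))

/-- The scale `τ_N = ln N`. -/
def tau (N : ℕ) : ℝ := Real.log N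

/-- The rescaled period `2 π τ_N ω`. -/
def period (ω : ℝ) (N : ℕ) : ℝ := 2 * Real.pi * tau N * ω

/-- The rescaled confining potential `V_{N;α}`. -/
def potential (r α : ℝ) (ε : ℝ → ℝ) (N : ℕ) (x : ℝ) : ℝ :=
  r / (N * tau N) * Real.cosh (tau N * x) - α * x / N
    - ∫ y, 1 / (2 * Real.pi * N) * (gFun ε (tau N * y) / Real.cosh (tau N * (x - y)))

/-- The two-body interaction
`ln (sinh (ω̄₁ (s - t) / 2) * sinh (ω̄₂ (s - t) / 2))`, for `s ≠ t`. Its value on the diagonal should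
be `-∞`; that point is taken care of in `FiniteEnergy`. -/
def interaction (ω₁ ω₂ : ℝ) (N : ℕ) (s t : ℝ) : ℝ :=
  Real.log (Real.sinh (period ω₁ N * (s - t) / 2) * Real.sinh (period ω₂ N * (s - t) / 2))

/-- The two integrals in the energy functional are finite. The first field says that the diagonal,
where the interaction is `-∞`, is a null set. -/
structure FiniteEnergy (r α ω₁ ω₂ : ℝ) (ε : ℝ → ℝ) (N : ℕ) (μ : Measure ℝ) : Prop where
  offDiagonal : ∀ᵐ p ∂(μ.prod μ), p.1 ≠ p.2
  potential : Integrable (potential r α ε N) μ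
  interaction : Integrable (fun p : ℝ × ℝ => interaction ω₁ ω₂ N p.1 p.2) (μ.prod μ)

open Classical in
/-- The energy functional `E_N` on probability measures, with values in `(-∞, +∞]`. For `N ≥ 2` the
potential is bounded below and grows exponentially while the interaction is bounded above by a
linear function of `|s| + |t|`, so that `E_N[μ] = +∞` as soon as one of the integrals is not
finite. -/
def energy (r α ω₁ ω₂ : ℝ) (ε : ℝ → ℝ) (N : ℕ) (μ : Measure ℝ) : EReal :=
  if FiniteEnergy r α ω₁ ω₂ ε N μ then
    (((∫ s, potential r α ε N s ∂μ)
      - 1 / (2 * tau N) * ∫ p, interaction ω₁ ω₂ N p.1 p.2 ∂(μ.prod μ) : ℝ) : EReal)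
  else ⊤

/-- `μ` is an equilibrium measure: it minimises `E_N` over all probability measures on `ℝ`. -/
def IsEquilibriumMeasure (r α ω₁ ω₂ : ℝ) (ε : ℝ → ℝ) (N : ℕ) (μ : ProbabilityMeasure ℝ) : Prop :=
  ∀ ν : ProbabilityMeasure ℝ,
    energy r α ω₁ ω₂ ε N (μ : Measure ℝ) ≤ energy r α ω₁ ω₂ ε N (ν : Measure ℝ)

end

end LukyanovIntegral

/-!
The proof compares the energy of a minimiser `μ` with the energies of three explicit competitors;
neither the Euler-Lagrange equations nor the shape of the equilibrium measure is needed.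

The TBA equation enters only through the integrability of `g`: the potential is
`r / (N τ) cosh (τ x) - α x / N` up to a term between `0` and `(∫ g) / (N τ)`, where `τ = ln N`.
The interaction is at most `π (ω₁ + ω₂) τ |s - t|`, and at distances at most `1` it is at least this
up to an error independent of `N` with a logarithmic singularity (`interaction_le`,
`le_interaction`).

* The uniform measure on `[0, 1]` has energy at most `- π (ω₁ + ω₂) D / 2 + O(1 / τ)`, with `D > 0`
  the mean distance of two independent uniform points (`energyValue_uniformMeasure_le`). In
  particular minimisers have finite energy.
* The normalised restriction of `μ` to `[-R, R]`: since the potential beats the interaction at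
  infinity, `μ` has no mass far away, so its support is compact and has end points
  (`exists_ae_abs_le_of_le_restrict`).
* The translates of `μ` by `± ln 2 / τ` have the same interaction energy. If `μ` is carried by
  `(-∞, ς]` or by `[-ς, ∞)`, comparing the potential energies gives
  `∫ cosh (τ x) dμ ≤ (3 / 2) N ^ ς + O(1)` (`IsEquilibriumMeasure.integral_cosh_le`), hence
  `∫ |x| dμ ≤ 2 ς + O(1 / τ)` (`integral_abs_le`).

In the last situation the energy of `μ` is at least `- 2 π (ω₁ + ω₂) ς - O(1 / τ)`
(`le_energyValue`). For `ς = D / 8` and `N` large this exceeds the energy of the uniform measure, so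
the support of a minimiser reaches beyond `ς` and `-ς`.
-/

namespace LukyanovIntegral

/-! ### Elementary inequalities -/

lemma one_add_sq_div_two_le_cosh (x : ℝ) : 1 + x ^ 2 / 2 ≤ Real.cosh x := by
  have h1 : Real.cosh x = 1 + 2 * Real.sinh (x / 2) ^ 2 := by
    have h := Real.cosh_two_mul (x / 2)
    rw [Real.cosh_sq, mul_div_cancel₀ x two_ne_zero] at h
    linarith
  have h2 : (x / 2) ^ 2 ≤ Real.sinh (x / 2) ^ 2 := by
    rw [sq_le_sq, Real.abs_sinh]
    exact Real.self_le_sinh_iff.2 (abs_nonneg _)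
  rw [h1]
  linarith

lemma abs_le_cosh (x : ℝ) : |x| ≤ Real.cosh x := by
  have h := one_add_sq_div_two_le_cosh x
  rw [← sq_abs] at h
  nlinarith [sq_nonneg (|x| - 1)]

/-- Since `1 - exp (-v) ≥ v / (1 + v)`, the function `sinh u` is bounded below by `exp u` up to a
factor that is comparable with `u` near `0` and with a constant at infinity. -/
lemma exp_mul_div_le_sinh {u : ℝ} (hu : 0 ≤ u) :
    Real.exp u * (u / (1 + 2 * u)) ≤ Real.sinh u := by
  have h1 : 1 + 2 * u ≤ Real.exp (2 * u) := by linarith [Real.add_one_le_exp (2 * u)]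
  have h2 : Real.exp (-u) * Real.exp (2 * u) = Real.exp u := by
    rw [← Real.exp_add]; congr 1; ring
  have h3 : 0 < 1 + 2 * u := by linarith
  have h4 : Real.exp (-u) * (1 + 2 * u) ≤ Real.exp u := by
    rw [← h2]; exact mul_le_mul_of_nonneg_left h1 (Real.exp_pos _).le
  rw [Real.sinh_eq, ← mul_div_assoc, div_le_div_iff₀ h3 two_pos]
  nlinarith

lemma log_sinh_le {u : ℝ} (hu : 0 < u) : Real.log (Real.sinh u) ≤ u := by
  rw [Real.log_le_iff_le_exp (Real.sinh_pos_iff.2 hu), Real.sinh_eq]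
  linarith [Real.exp_pos u, Real.exp_pos (-u)]

lemma le_log_sinh {u : ℝ} (hu : 0 < u) :
    u + Real.log u - Real.log (1 + 2 * u) ≤ Real.log (Real.sinh u) := by
  have h3 : 0 < 1 + 2 * u := by linarith
  have h := Real.log_le_log (by positivity) (exp_mul_div_le_sinh hu.le)
  rw [Real.log_mul (Real.exp_pos _).ne' (by positivity), Real.log_exp,
    Real.log_div hu.ne' h3.ne'] at h
  linarith

/-! ### The function `g` of the thermodynamic Bethe Ansatz -/

lemma tbaKernel_nonneg {b : ℝ} (x : ℝ) : 0 ≤ tbaKernel b x := by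
  have h1 : 0 ≤ Real.sin (Real.pi / (1 + b ^ 2)) := by
    apply Real.sin_nonneg_of_nonneg_of_le_pi
    · positivity
    · exact div_le_self Real.pi_pos.le (by nlinarith [sq_nonneg b])
  have h2 := Real.one_le_cosh (2 * x)
  have h3 := Real.cos_le_one (2 * Real.pi / (1 + b ^ 2))
  have h4 := Real.cosh_pos x
  exact div_nonneg (by positivity) (by linarith)

lemma log_one_add_exp_nonneg (x : ℝ) : 0 ≤ Real.log (1 + Real.exp x) :=
  Real.log_nonneg (by linarith [Real.exp_pos x])

lemma gFun_nonneg (ε : ℝ → ℝ) (y : ℝ) : 0 ≤ gFun ε y :=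
  mul_nonneg two_pos.le (log_one_add_exp_nonneg _)

/-- A solution of the TBA equation dominates its driving term, because the kernel is positive.
Hence `g` is dominated by a multiple of `exp (-c cosh x)` with `c > 0`. -/
lemma IsTBASolution.integrable_gFun {b r : ℝ} {ε : ℝ → ℝ} (hb : 0 < b) (hr : 0 < r)
    (h : IsTBASolution b r ε) : Integrable (gFun ε) := by
  set c := 2 * r * Real.sin (Real.pi / (1 + b ^ 2)) with hc_def
  have hc : 0 < c := by
    have h1 : 0 < Real.sin (Real.pi / (1 + b ^ 2)) := by
      apply Real.sin_pos_of_pos_of_lt_pi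
      · positivity
      · exact div_lt_self Real.pi_pos (by nlinarith [pow_pos hb 2])
    positivity
  have hmeas : AEStronglyMeasurable (gFun ε) volume := by
    have := h.aemeasurable
    unfold gFun
    exact (((this.neg.exp.const_add 1).log).const_mul 2).aestronglyMeasurable
  refine Integrable.mono' (integrable_inv_one_add_sq.const_mul (4 / c)) hmeas ?_
  filter_upwards [h.equation] with x hx
  have hint : 0 ≤ ∫ y, tbaKernel b (x - y) * Real.log (1 + Real.exp (-ε y)) :=
    integral_nonneg fun y => mul_nonneg (tbaKernel_nonneg _) (log_one_add_exp_nonneg _)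
  have h1 : c * ((1 + x ^ 2) / 2) ≤ ε x := by
    have := mul_le_mul_of_nonneg_left (one_add_sq_div_two_le_cosh x) hc.le
    nlinarith
  rw [Real.norm_of_nonneg (gFun_nonneg ε x)]
  have h2 : Real.log (1 + Real.exp (-ε x)) ≤ Real.exp (-ε x) := by
    have := Real.log_le_sub_one_of_pos (x := 1 + Real.exp (-ε x)) (by positivity)
    linarith
  have h0 : 0 < c * ((1 + x ^ 2) / 2) := by positivity
  have h3 : Real.exp (-ε x) ≤ (c * ((1 + x ^ 2) / 2))⁻¹ := by
    rw [Real.exp_neg]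
    apply inv_anti₀ h0
    linarith [Real.add_one_le_exp (ε x)]
  have h4 : 4 / c * (1 + x ^ 2)⁻¹ = 2 * (c * ((1 + x ^ 2) / 2))⁻¹ := by
    have : 1 + x ^ 2 ≠ 0 := by positivity
    field_simp
    norm_num
  rw [h4, gFun]
  linarith

/-! ### The confining potential -/

/-- The bounded part of the potential, that is the smoothing of `g` by `1 / cosh`. -/
noncomputable def smoothing (ε : ℝ → ℝ) (N : ℕ) (x : ℝ) : ℝ :=
  ∫ y, 1 / (2 * Real.pi * N) * (gFun ε (tau N * y) / Real.cosh (tau N * (x - y)))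

lemma potential_eq (r α : ℝ) (ε : ℝ → ℝ) (N : ℕ) (x : ℝ) :
    potential r α ε N x =
      r / (N * tau N) * Real.cosh (tau N * x) - α * x / N - smoothing ε N x := rfl

lemma smoothing_nonneg (ε : ℝ → ℝ) (N : ℕ) (x : ℝ) : 0 ≤ smoothing ε N x :=
  integral_nonneg fun y => mul_nonneg (by positivity)
    (div_nonneg (gFun_nonneg _ _) (Real.cosh_pos _).le)

section

variable {ε : ℝ → ℝ} {N : ℕ}

lemma smoothing_integrand_le (ε : ℝ → ℝ) (N : ℕ) (x y : ℝ) :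
    1 / (2 * Real.pi * N) * (gFun ε (tau N * y) / Real.cosh (tau N * (x - y))) ≤
      1 / (2 * Real.pi * N) * gFun ε (tau N * y) :=
  mul_le_mul_of_nonneg_left (div_le_self (gFun_nonneg _ _) (Real.one_le_cosh _)) (by positivity)

lemma aestronglyMeasurable_smoothing_integrand (hg : Integrable (gFun ε)) (hτ : 0 < tau N)
    (x : ℝ) : AEStronglyMeasurable
      (fun y => 1 / (2 * Real.pi * N) * (gFun ε (tau N * y) / Real.cosh (tau N * (x - y))))
      volume := by
  have h1 := (hg.comp_mul_left' hτ.ne').aestronglyMeasurable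
  have h2 : Continuous fun y : ℝ => (Real.cosh (tau N * (x - y)))⁻¹ :=
    Continuous.inv₀ (by fun_prop) fun y => (Real.cosh_pos _).ne'
  simp only [div_eq_mul_inv]
  exact (h1.mul h2.aestronglyMeasurable).const_mul _

lemma continuous_smoothing (hg : Integrable (gFun ε)) (hτ : 0 < tau N) :
    Continuous (smoothing ε N) := by
  have h1 := hg.comp_mul_left' hτ.ne'
  refine continuous_of_dominated (aestronglyMeasurable_smoothing_integrand hg hτ)
    (fun x => Filter.Eventually.of_forall fun y => ?_) (h1.const_mul (1 / (2 * Real.pi * N)))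
    (Filter.Eventually.of_forall fun y => ?_)
  · rw [Real.norm_of_nonneg (mul_nonneg (by positivity)
      (div_nonneg (gFun_nonneg _ _) (Real.cosh_pos _).le))]
    exact smoothing_integrand_le ε N x y
  · exact continuous_const.mul (continuous_const.div (by fun_prop) fun x => (Real.cosh_pos _).ne')

lemma smoothing_le (hg : Integrable (gFun ε)) (hN : 0 < N) (hτ : 0 < tau N) (x : ℝ) :
    smoothing ε N x ≤ (∫ y, gFun ε y) / (N * tau N) := by
  have h1 := hg.comp_mul_left' hτ.ne'
  have hNr : (0 : ℝ) < N := Nat.cast_pos.2 hN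
  calc smoothing ε N x ≤ ∫ y, 1 / (2 * Real.pi * N) * gFun ε (tau N * y) := by
        refine integral_mono_of_nonneg (Filter.Eventually.of_forall fun y => ?_)
          (h1.const_mul _) (Filter.Eventually.of_forall fun y => smoothing_integrand_le ε N x y)
        exact mul_nonneg (by positivity) (div_nonneg (gFun_nonneg _ _) (Real.cosh_pos _).le)
    _ = 1 / (2 * Real.pi) * ((∫ y, gFun ε y) / (N * tau N)) := by
        rw [integral_const_mul, Measure.integral_comp_mul_left, abs_of_pos (inv_pos.2 hτ),
          smul_eq_mul]
        field_simp
    _ ≤ (∫ y, gFun ε y) / (N * tau N) := by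
        refine mul_le_of_le_one_left
          (div_nonneg (integral_nonneg (gFun_nonneg ε)) (by positivity)) ?_
        rw [div_le_one (by positivity)]
        linarith [Real.pi_gt_three]

/-- Half of the exponential growth of the potential absorbs its linear and bounded parts. -/
lemma half_cosh_sub_le_potential {r : ℝ} (hr : 0 < r) (α : ℝ) (hg : Integrable (gFun ε))
    (hN : 0 < N) (hτ : 0 < tau N) (x : ℝ) :
    r / (2 * N * tau N) * Real.cosh (tau N * x)
        - (α ^ 2 / r + ∫ y, gFun ε y) / (N * tau N) ≤ potential r α ε N x := by
  have hNr : (0 : ℝ) < N := Nat.cast_pos.2 hN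
  have h1 := smoothing_le hg hN hτ x
  have h2 := one_add_sq_div_two_le_cosh (tau N * x)
  have h3 : α * (tau N * x) ≤ r / 2 * Real.cosh (tau N * x) + α ^ 2 / r := by
    have h4 : α * (tau N * x) ≤ r / 2 * ((tau N * x) ^ 2 / 2) + α ^ 2 / r := by
      have h5 : r / 2 * ((tau N * x) ^ 2 / 2) + α ^ 2 / r - α * (tau N * x)
          = (r * (tau N * x) / 2 - α) ^ 2 / r := by
        field_simp
        ring
      have h6 : 0 ≤ (r * (tau N * x) / 2 - α) ^ 2 / r := by positivity
      linarith
    nlinarith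
  have h7 : α * x / N ≤ (r / 2 * Real.cosh (tau N * x) + α ^ 2 / r) / (N * tau N) := by
    rw [le_div_iff₀ (by positivity)]
    calc α * x / N * (N * tau N) = α * (tau N * x) := by field_simp
      _ ≤ _ := h3
  have h8 : (r / 2 * Real.cosh (tau N * x) + α ^ 2 / r) / (N * tau N)
      + r / (2 * N * tau N) * Real.cosh (tau N * x)
      - (α ^ 2 / r + ∫ y, gFun ε y) / (N * tau N)
      = r / (N * tau N) * Real.cosh (tau N * x) - (∫ y, gFun ε y) / (N * tau N) := by
    field_simp
    ring
  rw [potential_eq]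
  linarith

lemma abs_le_cosh_div (hτ : 0 < tau N) (x : ℝ) : |x| ≤ Real.cosh (tau N * x) / tau N := by
  rw [le_div_iff₀ hτ, mul_comm, ← abs_of_pos hτ, ← abs_mul, abs_of_pos hτ]
  exact abs_le_cosh _

lemma integrable_abs_of_cosh {μ : Measure ℝ} (hτ : 0 < tau N)
    (h : Integrable (fun x => Real.cosh (tau N * x)) μ) : Integrable (fun x => |x|) μ :=
  (h.div_const (tau N)).mono' (by fun_prop) <| Filter.Eventually.of_forall fun x => by
    rw [Real.norm_eq_abs, abs_abs]; exact abs_le_cosh_div hτ x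

lemma integrable_potential_of_cosh {μ : Measure ℝ} [IsFiniteMeasure μ] (r α : ℝ)
    (hg : Integrable (gFun ε)) (hN : 0 < N) (hτ : 0 < tau N)
    (h : Integrable (fun x => Real.cosh (tau N * x)) μ) : Integrable (potential r α ε N) μ := by
  have hx : Integrable (fun x : ℝ => x) μ :=
    (integrable_abs_of_cosh hτ h).mono (by fun_prop) (by simp)
  have hs : Integrable (smoothing ε N) μ :=
    (integrable_const ((∫ y, gFun ε y) / (N * tau N))).mono'
      (continuous_smoothing hg hτ).aestronglyMeasurable <| Filter.Eventually.of_forall fun x => by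
        rw [Real.norm_of_nonneg (smoothing_nonneg ε N x)]; exact smoothing_le hg hN hτ x
  exact ((h.const_mul (r / (N * tau N))).sub ((hx.const_mul α).div_const N)).sub hs

lemma integrable_cosh_of_potential {μ : Measure ℝ} [IsFiniteMeasure μ] {r : ℝ} (hr : 0 < r)
    (α : ℝ) (hg : Integrable (gFun ε)) (hN : 0 < N) (hτ : 0 < tau N)
    (h : Integrable (potential r α ε N) μ) :
    Integrable (fun x => Real.cosh (tau N * x)) μ := by
  have hNr : (0 : ℝ) < N := Nat.cast_pos.2 hN
  have hk : 0 < r / (2 * N * tau N) := by positivity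
  refine ((h.add (integrable_const ((α ^ 2 / r + ∫ y, gFun ε y) / (N * tau N)))).const_mul
    (r / (2 * N * tau N))⁻¹).mono' (by fun_prop) <| Filter.Eventually.of_forall fun x => ?_
  rw [Real.norm_of_nonneg (Real.cosh_pos _).le, ← div_eq_inv_mul, le_div_iff₀ hk]
  have := half_cosh_sub_le_potential hr α hg hN hτ x
  simp only [Pi.add_apply]
  linarith

end

/-! ### The two-body interaction -/

section

variable {ω₁ ω₂ : ℝ} {N : ℕ}

lemma interaction_eq (hω₁ : 0 < ω₁) (hω₂ : 0 < ω₂) (hτ : 0 < tau N) {s t : ℝ} (hst : s ≠ t) :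
    interaction ω₁ ω₂ N s t =
      Real.log (Real.sinh (Real.pi * tau N * ω₁ * |s - t|))
        + Real.log (Real.sinh (Real.pi * tau N * ω₂ * |s - t|)) := by
  have hd : 0 < |s - t| := abs_pos.2 (sub_ne_zero.2 hst)
  have hpi := Real.pi_pos
  have h1 : 0 < Real.sinh (Real.pi * tau N * ω₁ * |s - t|) := Real.sinh_pos_iff.2 (by positivity)
  have h2 : 0 < Real.sinh (Real.pi * tau N * ω₂ * |s - t|) := Real.sinh_pos_iff.2 (by positivity)
  rw [← Real.log_mul h1.ne' h2.ne', interaction]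
  have e : ∀ ω : ℝ, period ω N * (s - t) / 2 = Real.pi * tau N * ω * (s - t) := by
    intro ω; unfold period; ring
  rw [e, e]
  rcases abs_choice (s - t) with h | h
  · rw [h]
  · rw [h, mul_neg, mul_neg, Real.sinh_neg, Real.sinh_neg, neg_mul_neg]

lemma interaction_self (s : ℝ) : interaction ω₁ ω₂ N s s = 0 := by simp [interaction]

lemma measurable_interaction : Measurable fun p : ℝ × ℝ => interaction ω₁ ω₂ N p.1 p.2 := by
  unfold interaction
  fun_prop

lemma interaction_le (hω₁ : 0 < ω₁) (hω₂ : 0 < ω₂) (hτ : 0 < tau N) (s t : ℝ) :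
    interaction ω₁ ω₂ N s t ≤ Real.pi * (ω₁ + ω₂) * tau N * |s - t| := by
  rcases eq_or_ne s t with rfl | hst
  · simp [interaction_self]
  have hd : 0 < |s - t| := abs_pos.2 (sub_ne_zero.2 hst)
  have hpi := Real.pi_pos
  rw [interaction_eq hω₁ hω₂ hτ hst]
  have h1 := log_sinh_le (u := Real.pi * tau N * ω₁ * |s - t|) (by positivity)
  have h2 := log_sinh_le (u := Real.pi * tau N * ω₂ * |s - t|) (by positivity)
  linarith

/-- A lower bound for `ln sinh (k d)` on `0 < d ≤ 1` whose error term is uniform in `k ≥ k₀`. -/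
lemma le_log_sinh_mul {k k₀ d : ℝ} (hk₀ : 0 < k₀) (hk : k₀ ≤ k) (hd : 0 < d) (hd1 : d ≤ 1) :
    k * d + Real.log d - (1 + 1 / k₀) ≤ Real.log (Real.sinh (k * d)) := by
  have hk' : 0 < k := hk₀.trans_le hk
  have h1 := le_log_sinh (u := k * d) (by positivity)
  have h2 : Real.log (1 + 2 * (k * d)) ≤ Real.log (1 + 2 * k) :=
    Real.log_le_log (by positivity) (by nlinarith)
  have h3 : Real.log (1 + 2 * k) - Real.log k ≤ 1 + 1 / k₀ := by
    rw [← Real.log_div (by positivity) hk'.ne']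
    have h4 := Real.log_le_sub_one_of_pos (x := (1 + 2 * k) / k) (by positivity)
    have h5 : (1 + 2 * k) / k = 1 / k + 2 := by field_simp
    have h6 : 1 / k ≤ 1 / k₀ := one_div_le_one_div_of_le hk₀ hk
    rw [h5] at h4 ⊢
    linarith
  rw [Real.log_mul hk'.ne' hd.ne'] at h1
  linarith

/-- At distances at most `1` the linear upper bound on the interaction is sharp, up to a logarithmic
singularity and a constant that do not depend on `N`. -/
lemma le_interaction (hω₁ : 0 < ω₁) (hω₂ : 0 < ω₂) (hτ : 1 ≤ tau N) {s t : ℝ}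
    (hst : |s - t| ≤ 1) :
    Real.pi * (ω₁ + ω₂) * tau N * |s - t| + 2 * Real.log (s - t)
        - (2 + 1 / (Real.pi * ω₁) + 1 / (Real.pi * ω₂)) ≤ interaction ω₁ ω₂ N s t := by
  have hpi := Real.pi_pos
  rcases eq_or_ne s t with rfl | hne
  · have : 0 ≤ 2 + 1 / (Real.pi * ω₁) + 1 / (Real.pi * ω₂) := by positivity
    simp only [interaction_self, sub_self, abs_zero, mul_zero, Real.log_zero]
    linarith
  have hd : 0 < |s - t| := abs_pos.2 (sub_ne_zero.2 hne)
  rw [interaction_eq hω₁ hω₂ (by linarith) hne, ← Real.log_abs (s - t)]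
  have h1 := le_log_sinh_mul (k := Real.pi * tau N * ω₁) (k₀ := Real.pi * ω₁) (by positivity)
    (by nlinarith [mul_pos hpi hω₁]) hd hst
  have h2 := le_log_sinh_mul (k := Real.pi * tau N * ω₂) (k₀ := Real.pi * ω₂) (by positivity)
    (by nlinarith [mul_pos hpi hω₂]) hd hst
  linarith

end

/-! ### Energies of competing measures -/

/-- The value of the energy functional on measures of finite energy. -/
noncomputable def energyValue (r α ω₁ ω₂ : ℝ) (ε : ℝ → ℝ) (N : ℕ) (μ : Measure ℝ) : ℝ :=
  (∫ s, potential r α ε N s ∂μ)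
    - 1 / (2 * tau N) * ∫ p, interaction ω₁ ω₂ N p.1 p.2 ∂(μ.prod μ)

section

variable {r α ω₁ ω₂ : ℝ} {ε : ℝ → ℝ} {N : ℕ}

lemma IsEquilibriumMeasure.finiteEnergy {μ ν : ProbabilityMeasure ℝ}
    (h : IsEquilibriumMeasure r α ω₁ ω₂ ε N μ)
    (hν : FiniteEnergy r α ω₁ ω₂ ε N (ν : Measure ℝ)) :
    FiniteEnergy r α ω₁ ω₂ ε N (μ : Measure ℝ) := by
  by_contra hμ
  have := h ν
  rw [energy, energy, if_neg hμ, if_pos hν] at this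
  exact EReal.coe_ne_top _ (top_le_iff.1 this)

lemma IsEquilibriumMeasure.energyValue_le {μ : ProbabilityMeasure ℝ}
    (h : IsEquilibriumMeasure r α ω₁ ω₂ ε N μ)
    (hμ : FiniteEnergy r α ω₁ ω₂ ε N (μ : Measure ℝ))
    (ν : Measure ℝ) [IsProbabilityMeasure ν] (hν : FiniteEnergy r α ω₁ ω₂ ε N ν) :
    energyValue r α ω₁ ω₂ ε N (μ : Measure ℝ) ≤ energyValue r α ω₁ ω₂ ε N ν := by
  have := h ⟨ν, inferInstance⟩
  rw [energy, energy, if_pos hμ, ProbabilityMeasure.coe_mk, if_pos hν] at this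
  exact EReal.coe_le_coe_iff.1 this

/-- The interaction is invariant under translations, so only the potential energy changes when a
minimiser is translated. -/
lemma IsEquilibriumMeasure.integral_potential_le_translate {μ : ProbabilityMeasure ℝ}
    (h : IsEquilibriumMeasure r α ω₁ ω₂ ε N μ)
    (hμ : FiniteEnergy r α ω₁ ω₂ ε N (μ : Measure ℝ)) (a : ℝ)
    (ha : Integrable (fun x => potential r α ε N (x + a)) (μ : Measure ℝ)) :
    ∫ x, potential r α ε N x ∂(μ : Measure ℝ) ≤
      ∫ x, potential r α ε N (x + a) ∂(μ : Measure ℝ) := by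
  set e : ℝ ≃ᵐ ℝ := MeasurableEquiv.addRight a with he
  have hp : ((μ : Measure ℝ).map e).prod ((μ : Measure ℝ).map e)
      = ((μ : Measure ℝ).prod (μ : Measure ℝ)).map (e.prodCongr e) :=
    Measure.map_prod_map _ _ e.measurable e.measurable
  have hI : (fun p : ℝ × ℝ => interaction ω₁ ω₂ N p.1 p.2) ∘ (e.prodCongr e)
      = fun p => interaction ω₁ ω₂ N p.1 p.2 := by
    funext p
    change interaction ω₁ ω₂ N (p.1 + a) (p.2 + a) = _
    simp [interaction]
  have : IsProbabilityMeasure ((μ : Measure ℝ).map e) :=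
    Measure.isProbabilityMeasure_map e.measurable.aemeasurable
  have hν : FiniteEnergy r α ω₁ ω₂ ε N ((μ : Measure ℝ).map e) := by
    refine ⟨?_, ?_, ?_⟩
    · rw [hp, (e.prodCongr e).measurableEmbedding.ae_map_iff]
      filter_upwards [hμ.offDiagonal] with p hne
      exact fun h => hne (add_right_cancel h)
    · rw [integrable_map_equiv]
      exact ha
    · rw [hp, integrable_map_equiv, hI]
      exact hμ.interaction
  have h1 := h.energyValue_le hμ _ hν
  have h2 := integral_map_equiv (μ := (μ : Measure ℝ).prod (μ : Measure ℝ)) (e.prodCongr e)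
    (fun p : ℝ × ℝ => interaction ω₁ ω₂ N p.1 p.2)
  rw [energyValue, energyValue, hp, h2, integral_map_equiv] at h1
  have h3 := congrArg (fun f => ∫ p, f p ∂((μ : Measure ℝ).prod (μ : Measure ℝ))) hI
  simp only [Function.comp_apply] at h3
  rw [h3] at h1
  exact (sub_le_sub_iff_right _).1 h1

end

/-! ### The uniform measure on the unit interval as a competitor -/

/-- The uniform probability measure on `[0, 1]`. -/
noncomputable def uniformMeasure : Measure ℝ := volume.restrict (Set.Icc 0 1)

instance : IsProbabilityMeasure uniformMeasure :=
  ⟨by simp [uniformMeasure]⟩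

lemma uniformMeasure_prod :
    uniformMeasure.prod uniformMeasure
      = (volume.prod volume).restrict (Set.Icc (0 : ℝ) 1 ×ˢ Set.Icc (0 : ℝ) 1) :=
  Measure.prod_restrict _ _

lemma ae_uniformMeasure_prod_mem :
    ∀ᵐ p ∂(uniformMeasure.prod uniformMeasure),
      p.1 ∈ Set.Icc (0 : ℝ) 1 ∧ p.2 ∈ Set.Icc (0 : ℝ) 1 := by
  rw [uniformMeasure_prod]
  exact ae_restrict_mem (measurableSet_Icc.prod measurableSet_Icc)

lemma uniformMeasure_offDiagonal :
    ∀ᵐ p ∂(uniformMeasure.prod uniformMeasure), p.1 ≠ p.2 := by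
  have hm : MeasurableSet {p : ℝ × ℝ | ¬ p.1 ≠ p.2} := by
    simpa using measurableSet_eq_fun measurable_fst measurable_snd
  rw [ae_iff, Measure.measure_prod_null hm]
  refine Filter.Eventually.of_forall fun x => ?_
  have : Prod.mk x ⁻¹' {p : ℝ × ℝ | ¬ p.1 ≠ p.2} = {x} := by
    ext y; simp [eq_comm]
  change uniformMeasure _ = 0
  rw [this]
  simp [uniformMeasure]

lemma integrable_log_sub_uniformMeasure :
    Integrable (fun p : ℝ × ℝ => Real.log (p.1 - p.2)) (uniformMeasure.prod uniformMeasure) := by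
  have h1 : Integrable ((Set.Icc (0 : ℝ) 1).indicator fun _ => (1 : ℝ)) volume :=
    (integrable_indicator_iff measurableSet_Icc).2 (integrableOn_const (by simp))
  have h2 : Integrable ((Set.Icc (-1 : ℝ) 1).indicator Real.log) volume := by
    rw [integrable_indicator_iff measurableSet_Icc,
      ← intervalIntegrable_iff_integrableOn_Icc_of_le (by norm_num)]
    exact intervalIntegral.intervalIntegrable_log'
  have h3 := (h1.convolution_integrand (ContinuousLinearMap.mul ℝ ℝ) h2).restrict
    (s := Set.Icc (0 : ℝ) 1 ×ˢ Set.Icc (0 : ℝ) 1)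
  rw [uniformMeasure_prod]
  refine h3.congr ?_
  filter_upwards [ae_restrict_mem (measurableSet_Icc.prod measurableSet_Icc)] with p hp
  obtain ⟨⟨h4, h5⟩, h6, h7⟩ := hp
  have h8 : p.1 - p.2 ∈ Set.Icc (-1 : ℝ) 1 := ⟨by linarith, by linarith⟩
  have h9 : p.2 ∈ Set.Icc (0 : ℝ) 1 := ⟨h6, h7⟩
  simp [Set.indicator_of_mem h8, Set.indicator_of_mem h9]

lemma integrable_abs_sub_uniformMeasure :
    Integrable (fun p : ℝ × ℝ => |p.1 - p.2|) (uniformMeasure.prod uniformMeasure) := by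
  refine (integrable_const (1 : ℝ)).mono' (by fun_prop) ?_
  filter_upwards [ae_uniformMeasure_prod_mem] with p ⟨⟨h1, h2⟩, h3, h4⟩
  rw [Real.norm_eq_abs, abs_abs, abs_le]
  constructor <;> linarith

lemma meanDistance_uniformMeasure_pos :
    0 < ∫ p : ℝ × ℝ, |p.1 - p.2| ∂(uniformMeasure.prod uniformMeasure) := by
  refine lt_of_le_of_ne (integral_nonneg fun p => abs_nonneg _) fun h => ?_
  have h1 := (integral_eq_zero_iff_of_nonneg (fun p : ℝ × ℝ => abs_nonneg (p.1 - p.2))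
    integrable_abs_sub_uniformMeasure).1 h.symm
  have h2 : ∀ᵐ p ∂(uniformMeasure.prod uniformMeasure), False := by
    filter_upwards [h1, uniformMeasure_offDiagonal] with p h3 h4
    exact h4 (sub_eq_zero.1 (abs_eq_zero.1 h3))
  rw [Filter.eventually_false_iff_eq_bot, ae_eq_bot] at h2
  exact IsProbabilityMeasure.ne_zero _ h2

section

variable {r α ω₁ ω₂ : ℝ} {ε : ℝ → ℝ} {N : ℕ}

lemma finiteEnergy_uniformMeasure (r α : ℝ) (hω₁ : 0 < ω₁) (hω₂ : 0 < ω₂)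
    (hg : Integrable (gFun ε)) (hN : 0 < N) (hτ : 1 ≤ tau N) :
    FiniteEnergy r α ω₁ ω₂ ε N uniformMeasure := by
  have hτ0 : 0 < tau N := by linarith
  refine ⟨uniformMeasure_offDiagonal, ?_, ?_⟩
  · refine integrable_potential_of_cosh r α hg hN hτ0 ?_
    exact (by fun_prop : Continuous fun x => Real.cosh (tau N * x)).integrableOn_Icc
  · set C := 2 + 1 / (Real.pi * ω₁) + 1 / (Real.pi * ω₂)
    have h1 := integrable_abs_sub_uniformMeasure.const_mul (Real.pi * (ω₁ + ω₂) * tau N)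
    have h2 := integrable_log_sub_uniformMeasure.const_mul 2
    refine ((h1.add h2.norm).add (integrable_const C)).mono'
      measurable_interaction.aestronglyMeasurable ?_
    filter_upwards [ae_uniformMeasure_prod_mem] with p ⟨⟨h3, h4⟩, h5, h6⟩
    have h7 : |p.1 - p.2| ≤ 1 := abs_le.2 ⟨by linarith, by linarith⟩
    have h8 := interaction_le hω₁ hω₂ hτ0 p.1 p.2
    have h9 := le_interaction hω₁ hω₂ hτ h7
    have hC : 0 ≤ C := by
      have := Real.pi_pos
      positivity
    have h10 : 0 ≤ Real.pi * (ω₁ + ω₂) * tau N * |p.1 - p.2| := by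
      have := Real.pi_pos
      positivity
    simp only [Pi.add_apply, Real.norm_eq_abs]
    rw [abs_le]
    have h11 := neg_abs_le (2 * Real.log (p.1 - p.2))
    have h12 := abs_nonneg (2 * Real.log (p.1 - p.2))
    constructor <;> linarith

lemma tau_le (hN : 0 < N) : tau N ≤ N := by
  have := Real.log_le_sub_one_of_pos (x := (N : ℝ)) (Nat.cast_pos.2 hN)
  unfold tau
  linarith

lemma exp_tau (hN : 0 < N) : Real.exp (tau N) = N := Real.exp_log (Nat.cast_pos.2 hN)

/-- On `[0, 1]` the potential is `O(1 / τ_N)`, so the energy of the uniform measure is, up to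
`O(1 / τ_N)`, the one of the repulsive interaction `- π (ω₁ + ω₂) |s - t| / 2`. -/
lemma energyValue_uniformMeasure_le (hr : 0 < r) (α : ℝ) (hω₁ : 0 < ω₁) (hω₂ : 0 < ω₂)
    (hg : Integrable (gFun ε)) (hN : 0 < N) (hτ : 1 ≤ tau N) :
    energyValue r α ω₁ ω₂ ε N uniformMeasure ≤
      (r + |α| + (2 + 1 / (Real.pi * ω₁) + 1 / (Real.pi * ω₂)) / 2
        - ∫ p : ℝ × ℝ, Real.log (p.1 - p.2) ∂(uniformMeasure.prod uniformMeasure)) / tau N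
      - Real.pi * (ω₁ + ω₂) / 2
        * ∫ p : ℝ × ℝ, |p.1 - p.2| ∂(uniformMeasure.prod uniformMeasure) := by
  have hτ0 : 0 < tau N := by linarith
  have hNr : (0 : ℝ) < N := Nat.cast_pos.2 hN
  have hE := finiteEnergy_uniformMeasure r α hω₁ hω₂ hg hN hτ
  set C := 2 + 1 / (Real.pi * ω₁) + 1 / (Real.pi * ω₂) with hC
  set D := ∫ p : ℝ × ℝ, |p.1 - p.2| ∂(uniformMeasure.prod uniformMeasure) with hD
  set J := ∫ p : ℝ × ℝ, Real.log (p.1 - p.2) ∂(uniformMeasure.prod uniformMeasure) with hJ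
  have hV : ∫ x, potential r α ε N x ∂uniformMeasure ≤ (r + |α|) / tau N := by
    have h1 : ∫ x, potential r α ε N x ∂uniformMeasure
        ≤ ∫ _x, (r + |α|) / tau N ∂uniformMeasure := by
      refine integral_mono_ae hE.potential (integrable_const _) ?_
      filter_upwards [ae_restrict_mem measurableSet_Icc] with x ⟨h0, h1⟩
      have h2 : Real.cosh (tau N * x) ≤ N := by
        rw [← exp_tau hN, Real.cosh_eq]
        have h3 : Real.exp (tau N * x) ≤ Real.exp (tau N) := Real.exp_le_exp.2 (by nlinarith)
        have h4 : Real.exp (-(tau N * x)) ≤ Real.exp (tau N) :=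
          Real.exp_le_exp.2 (by nlinarith)
        linarith
      have h5 : r / (N * tau N) * Real.cosh (tau N * x) ≤ r / tau N := by
        calc r / (N * tau N) * Real.cosh (tau N * x) ≤ r / (N * tau N) * N :=
              mul_le_mul_of_nonneg_left h2 (by positivity)
          _ = r / tau N := by field_simp
      have h6 : -(α * x / N) ≤ |α| / tau N := by
        calc -(α * x / N) ≤ |α * x / N| := neg_le_abs _
          _ = |α| * x / N := by rw [abs_div, abs_mul, abs_of_nonneg h0, abs_of_pos hNr]
          _ ≤ |α| / N := by
            gcongr
            exact mul_le_of_le_one_right (abs_nonneg _) h1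
          _ ≤ |α| / tau N := by
            gcongr
            exact tau_le hN
      have h7 := smoothing_nonneg ε N x
      rw [potential_eq, add_div]
      linarith
    simpa using h1
  have hI : Real.pi * (ω₁ + ω₂) * tau N * D + 2 * J - C ≤
      ∫ p, interaction ω₁ ω₂ N p.1 p.2 ∂(uniformMeasure.prod uniformMeasure) := by
    have h1 := integrable_abs_sub_uniformMeasure.const_mul (Real.pi * (ω₁ + ω₂) * tau N)
    have h2 := integrable_log_sub_uniformMeasure.const_mul 2
    have h12 : Integrable (fun p : ℝ × ℝ => Real.pi * (ω₁ + ω₂) * tau N * |p.1 - p.2|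
        + 2 * Real.log (p.1 - p.2)) (uniformMeasure.prod uniformMeasure) := h1.add h2
    calc Real.pi * (ω₁ + ω₂) * tau N * D + 2 * J - C
        = ∫ p : ℝ × ℝ, (Real.pi * (ω₁ + ω₂) * tau N * |p.1 - p.2| + 2 * Real.log (p.1 - p.2) - C)
            ∂(uniformMeasure.prod uniformMeasure) := by
          rw [integral_sub h12 (integrable_const _), integral_add h1 h2,
            integral_const_mul, integral_const_mul, ← hD, ← hJ]
          simp
      _ ≤ _ := by
          refine integral_mono_ae (h12.sub (integrable_const _)) hE.interaction ?_
          filter_upwards [ae_uniformMeasure_prod_mem] with p ⟨⟨h3, h4⟩, h5, h6⟩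
          exact le_interaction hω₁ hω₂ hτ (abs_le.2 ⟨by linarith, by linarith⟩)
  have h1 := mul_le_mul_of_nonneg_left hI (by positivity : 0 ≤ 1 / (2 * tau N))
  have h2 : 1 / (2 * tau N) * (Real.pi * (ω₁ + ω₂) * tau N * D + 2 * J - C)
      = Real.pi * (ω₁ + ω₂) / 2 * D + (J - C / 2) / tau N := by
    field_simp
    ring
  have h3 : (r + |α| + C / 2 - J) / tau N = (r + |α|) / tau N - (J - C / 2) / tau N := by ring
  rw [energyValue, h3]
  linarith

end

/-! ### Boundedness of the support -/

/-- If `μ` has no larger energy than its normalised restrictions to sets `B` of mass at least `1/2`,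
then `μ` is carried by a bounded set: removing a tail of small mass `m` changes the energy of the
rest by `O(m)`, whereas the energy per unit of mass of the tail grows quadratically with its
distance from the origin. -/
lemma exists_ae_abs_le_of_le_restrict {μ : Measure ℝ} [IsProbabilityMeasure μ] {V : ℝ → ℝ}
    {L : ℝ × ℝ → ℝ} {δ K c e : ℝ} (hδ : 0 < δ) (hc : 0 ≤ c) (he : 0 ≤ e)
    (hV : ∀ x, δ * x ^ 2 - K ≤ V x) (hL : ∀ p, L p ≤ c * (|p.1| + |p.2|))
    (hVi : Integrable V μ) (hLi : Integrable L (μ.prod μ)) (hxi : Integrable (fun x => |x|) μ)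
    (hmin : ∀ B, MeasurableSet B → 1 / 2 ≤ μ.real B →
      ∫ x, V x ∂μ - e * ∫ p, L p ∂(μ.prod μ) ≤
        (μ.real B)⁻¹ * ∫ x in B, V x ∂μ
          - e * ((μ.real B)⁻¹ * ((μ.real B)⁻¹ * ∫ p in B ×ˢ B, L p ∂(μ.prod μ)))) :
    ∃ R : ℝ, ∀ᵐ x ∂μ, |x| ≤ R := by
  set M := ∫ x, |x| ∂μ with hM
  have hM0 : 0 ≤ M := integral_nonneg fun x => abs_nonneg x
  set v := ∫ x, |V x| ∂μ with hv
  set l := ∫ p, |L p| ∂(μ.prod μ) with hl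
  set K₁ := 2 * v + 6 * e * l with hK₁
  set P := 2 * e * c with hP
  have hP0 : 0 ≤ P := by positivity
  set Q := K + P * M + K₁ + 1 with hQ
  -- The term `2 * M` makes the tail have mass at most `1 / 2` by Markov's inequality, and the
  -- other two make `V x - P * |x| - (P * M + K₁) ≥ 1` on the tail.
  set R := 1 + (P + |Q|) / δ + 2 * M with hR
  have hPQ : 0 ≤ (P + |Q|) / δ := by positivity
  have hR1 : 1 ≤ R := by linarith
  refine ⟨R, ?_⟩
  set A : Set ℝ := {x | R < |x|} with hA_def
  have hA : MeasurableSet A := measurableSet_lt measurable_const (by fun_prop)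
  set m := μ.real A with hm
  have hm0 : 0 ≤ m := measureReal_nonneg
  have hmhalf : m ≤ 1 / 2 := by
    have h1 := mul_meas_ge_le_integral_of_nonneg (μ := μ)
      (Filter.Eventually.of_forall fun x : ℝ => abs_nonneg x) hxi R
    have h2 : m ≤ μ.real {x | R ≤ |x|} := measureReal_mono fun x (hx : R < |x|) => hx.le
    nlinarith
  have hB : μ.real Aᶜ = 1 - m := by rw [measureReal_compl hA]; simp [hm]
  have hq := hmin Aᶜ hA.compl (by rw [hB]; linarith)
  rw [hB] at hq
  set q := (1 - m)⁻¹ with hq_def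
  have hm1 : 0 < 1 - m := by linarith
  have hq0 : 1 ≤ q := (one_le_inv₀ hm1).2 (by linarith)
  have hq1 : q ≤ 1 + 2 * m := by
    rw [hq_def, inv_le_iff_one_le_mul₀ hm1]
    nlinarith
  have hq2 : q * q ≤ 1 + 6 * m := by nlinarith
  have hsplit := integral_add_compl hA hVi
  have hsplit2 := integral_add_compl (hA.compl.prod hA.compl) hLi
  have hvB : |∫ x in Aᶜ, V x ∂μ| ≤ v :=
    (abs_integral_le_integral_abs).trans
      (setIntegral_le_integral hVi.abs (Filter.Eventually.of_forall fun x => abs_nonneg _))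
  have hlB : |∫ p in Aᶜ ×ˢ Aᶜ, L p ∂(μ.prod μ)| ≤ l :=
    (abs_integral_le_integral_abs).trans
      (setIntegral_le_integral hLi.abs (Filter.Eventually.of_forall fun x => abs_nonneg _))
  -- A pair outside `Aᶜ ×ˢ Aᶜ` has a component in `A`.
  have hw : ∫ p in (Aᶜ ×ˢ Aᶜ)ᶜ, L p ∂(μ.prod μ) ≤ 2 * c * ((∫ x in A, |x| ∂μ) + m * M) := by
    set f : ℝ → ℝ := A.indicator fun _ => 1 with hf
    set g : ℝ → ℝ := A.indicator fun x => |x| with hg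
    have hfi : Integrable f μ := (integrable_const 1).indicator hA
    have hgi : Integrable g μ := hxi.indicator hA
    have hone : Integrable (fun _ : ℝ => (1 : ℝ)) μ := integrable_const 1
    have i1 := hgi.mul_prod hone
    have i2 := hfi.mul_prod hxi
    have i3 := hxi.mul_prod hfi
    have i4 := hone.mul_prod hgi
    have i12 : Integrable (fun p : ℝ × ℝ => g p.1 * 1 + f p.1 * |p.2|) (μ.prod μ) := i1.add i2
    have i123 : Integrable (fun p : ℝ × ℝ => g p.1 * 1 + f p.1 * |p.2| + |p.1| * f p.2)
      (μ.prod μ) := i12.add i3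
    have i1234 : Integrable (fun p : ℝ × ℝ => g p.1 * 1 + f p.1 * |p.2| + |p.1| * f p.2
      + 1 * g p.2) (μ.prod μ) := i123.add i4
    have hms : MeasurableSet (Aᶜ ×ˢ Aᶜ)ᶜ := (hA.compl.prod hA.compl).compl
    have hfm : ∫ x, f x ∂μ = m := by
      rw [hf, integral_indicator hA]; simp [hm]
    have hgm : ∫ x, g x ∂μ = ∫ x in A, |x| ∂μ := integral_indicator hA
    calc ∫ p in (Aᶜ ×ˢ Aᶜ)ᶜ, L p ∂(μ.prod μ)
        = ∫ p, (Aᶜ ×ˢ Aᶜ)ᶜ.indicator L p ∂(μ.prod μ) := (integral_indicator hms).symm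
      _ ≤ ∫ p : ℝ × ℝ, c * (g p.1 * 1 + f p.1 * |p.2| + |p.1| * f p.2 + 1 * g p.2)
            ∂(μ.prod μ) := by
          refine integral_mono (hLi.indicator hms) (i1234.const_mul c) fun p => ?_
          have hLp := hL p
          have a1 := mul_nonneg hc (abs_nonneg p.1)
          have a2 := mul_nonneg hc (abs_nonneg p.2)
          by_cases h1 : p.1 ∈ A <;> by_cases h2 : p.2 ∈ A <;>
            simp [Set.indicator, hf, hg, h1, h2] <;> linarith
      _ = 2 * c * ((∫ x in A, |x| ∂μ) + m * M) := by
          rw [integral_const_mul, integral_add i123 i4, integral_add i12 i3, integral_add i1 i2,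
            integral_prod_mul g (fun _ => (1 : ℝ)), integral_prod_mul f (fun x => |x|),
            integral_prod_mul (fun x => |x|) f, integral_prod_mul (fun _ => (1 : ℝ)) g,
            hfm, hgm, ← hM]
          simp
          ring
  have hmain : ∫ x in A, V x ∂μ ≤ P * (∫ x in A, |x| ∂μ) + m * (P * M + K₁) := by
    have h1 : (q - 1) * ∫ x in Aᶜ, V x ∂μ ≤ 2 * m * v := by
      have := abs_le.1 hvB
      calc (q - 1) * ∫ x in Aᶜ, V x ∂μ ≤ (q - 1) * v :=
            mul_le_mul_of_nonneg_left this.2 (by linarith)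
        _ ≤ 2 * m * v := mul_le_mul_of_nonneg_right (by linarith) (by linarith)
    have h2 : -(e * ((q * q - 1) * ∫ p in Aᶜ ×ˢ Aᶜ, L p ∂(μ.prod μ))) ≤ e * (6 * m * l) := by
      have := abs_le.1 hlB
      rw [← mul_neg, ← mul_neg]
      refine mul_le_mul_of_nonneg_left ?_ he
      calc (q * q - 1) * -∫ p in Aᶜ ×ˢ Aᶜ, L p ∂(μ.prod μ) ≤ (q * q - 1) * l :=
            mul_le_mul_of_nonneg_left (by linarith) (by nlinarith)
        _ ≤ 6 * m * l := mul_le_mul_of_nonneg_right (by linarith) (by linarith)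
    have h3 := mul_le_mul_of_nonneg_left hw he
    rw [← hsplit, ← hsplit2] at hq
    linear_combination hq + h1 + h2 + h3
  have hlow : m ≤ ∫ x in A, (V x - P * |x| - (P * M + K₁)) ∂μ := by
    have hi : Integrable (fun x => V x - P * |x| - (P * M + K₁)) μ :=
      (hVi.sub (hxi.const_mul P)).sub (integrable_const _)
    calc m = ∫ _x in A, (1 : ℝ) ∂μ := by simp [hm]
      _ ≤ _ := by
        refine setIntegral_mono_on (integrable_const _) hi.integrableOn hA fun x hx => ?_
        have hx' : R < |x| := hx
        have h1 : (P + |Q|) * |x| ≤ δ * x ^ 2 := by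
          have h2 : (P + |Q|) / δ ≤ |x| := by linarith
          rw [div_le_iff₀ hδ] at h2
          calc (P + |Q|) * |x| ≤ |x| * δ * |x| := mul_le_mul_of_nonneg_right h2 (abs_nonneg x)
            _ = δ * x ^ 2 := by rw [← sq_abs]; ring
        have h3 : Q ≤ |Q| * |x| :=
          (le_abs_self Q).trans (le_mul_of_one_le_right (abs_nonneg Q) (hR1.trans hx'.le))
        have := hV x
        linarith
  have hm_eq : m = 0 := by
    have h1 : IntegrableOn (fun x => P * |x|) A μ := (hxi.const_mul P).integrableOn
    have h2 : IntegrableOn (fun x => V x - P * |x|) A μ := hVi.integrableOn.sub h1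
    rw [integral_sub h2 (integrable_const _), integral_sub hVi.integrableOn h1,
      integral_const_mul] at hlow
    simp only [integral_const, smul_eq_mul, measureReal_restrict_apply_univ, ← hm] at hlow
    linarith
  rw [hm, measureReal_eq_zero_iff] at hm_eq
  rw [ae_iff]
  simpa [hA_def] using hm_eq

section

variable {r α ω₁ ω₂ : ℝ} {ε : ℝ → ℝ} {N : ℕ} {μ : ProbabilityMeasure ℝ}

/-- Comparison of a minimiser with its normalised restriction to `B`. -/
lemma IsEquilibriumMeasure.energyValue_le_restrict
    (h : IsEquilibriumMeasure r α ω₁ ω₂ ε N μ)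
    (hμ : FiniteEnergy r α ω₁ ω₂ ε N (μ : Measure ℝ)) {B : Set ℝ}
    (hpos : 0 < (μ : Measure ℝ).real B) :
    energyValue r α ω₁ ω₂ ε N (μ : Measure ℝ) ≤
      ((μ : Measure ℝ).real B)⁻¹ * ∫ x in B, potential r α ε N x ∂(μ : Measure ℝ)
        - 1 / (2 * tau N) * (((μ : Measure ℝ).real B)⁻¹ * (((μ : Measure ℝ).real B)⁻¹ *
          ∫ p in B ×ˢ B, interaction ω₁ ω₂ N p.1 p.2 ∂((μ : Measure ℝ).prod (μ : Measure ℝ)))) := by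
  have h0 : (μ : Measure ℝ) B ≠ 0 := fun h => by simp [Measure.real, h] at hpos
  have : IsProbabilityMeasure (ProbabilityTheory.cond (μ : Measure ℝ) B) :=
    ProbabilityTheory.cond_isProbabilityMeasure h0
  have hprod : (ProbabilityTheory.cond (μ : Measure ℝ) B).prod
      (ProbabilityTheory.cond (μ : Measure ℝ) B)
      = ((μ : Measure ℝ) B)⁻¹ • ((μ : Measure ℝ) B)⁻¹ •
        ((μ : Measure ℝ).prod (μ : Measure ℝ)).restrict (B ×ˢ B) := by
    simp only [ProbabilityTheory.cond, Measure.prod_smul_left, Measure.prod_smul_right,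
      Measure.prod_restrict]
  have hfin : ((μ : Measure ℝ) B)⁻¹ ≠ ⊤ := ENNReal.inv_ne_top.2 h0
  have hν : FiniteEnergy r α ω₁ ω₂ ε N (ProbabilityTheory.cond (μ : Measure ℝ) B) := by
    refine ⟨?_, ?_, ?_⟩
    · rw [hprod]
      exact Measure.ae_smul_measure
        (Measure.ae_smul_measure (ae_restrict_of_ae hμ.offDiagonal) _) _
    · exact hμ.potential.restrict.smul_measure hfin
    · rw [hprod]
      exact (hμ.interaction.restrict.smul_measure hfin).smul_measure hfin
  have h1 := h.energyValue_le hμ _ hν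
  refine h1.trans_eq ?_
  rw [energyValue, hprod]
  simp only [ProbabilityTheory.cond, integral_smul_measure, ENNReal.toReal_inv, smul_eq_mul,
    Measure.real]

lemma IsEquilibriumMeasure.exists_ae_abs_le (h : IsEquilibriumMeasure r α ω₁ ω₂ ε N μ)
    (hμ : FiniteEnergy r α ω₁ ω₂ ε N (μ : Measure ℝ)) (hr : 0 < r) (hω₁ : 0 < ω₁) (hω₂ : 0 < ω₂)
    (hg : Integrable (gFun ε)) (hN : 0 < N) (hτ : 0 < tau N) :
    ∃ R : ℝ, ∀ᵐ x ∂(μ : Measure ℝ), |x| ≤ R := by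
  have hNr : (0 : ℝ) < N := Nat.cast_pos.2 hN
  have hpi := Real.pi_pos
  refine exists_ae_abs_le_of_le_restrict (V := potential r α ε N)
    (L := fun p => interaction ω₁ ω₂ N p.1 p.2) (δ := r * tau N / (4 * N))
    (K := (α ^ 2 / r + ∫ y, gFun ε y) / (N * tau N)) (c := Real.pi * (ω₁ + ω₂) * tau N)
    (e := 1 / (2 * tau N)) (by positivity) (by positivity) (by positivity) (fun x => ?_)
    (fun p => ?_) hμ.potential hμ.interaction
    (integrable_abs_of_cosh hτ (integrable_cosh_of_potential hr α hg hN hτ hμ.potential))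
    (fun B _ hB2 => h.energyValue_le_restrict hμ (by linarith))
  · refine le_trans ?_ (half_cosh_sub_le_potential hr α hg hN hτ x)
    have h1 : r / (2 * N * tau N) * ((tau N * x) ^ 2 / 2)
        ≤ r / (2 * N * tau N) * Real.cosh (tau N * x) :=
      mul_le_mul_of_nonneg_left (by linarith [one_add_sq_div_two_le_cosh (tau N * x)])
        (by positivity)
    have h2 : r / (2 * N * tau N) * ((tau N * x) ^ 2 / 2) = r * tau N / (4 * N) * x ^ 2 := by
      field_simp
      ring
    linarith
  · refine (interaction_le hω₁ hω₂ hτ p.1 p.2).trans ?_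
    exact mul_le_mul_of_nonneg_left (abs_sub _ _) (by positivity)

/-! ### A minimiser carried by a half-line would concentrate near the origin -/

/-- The translation of `y` that doubles `exp y` turns a bound on the increment of `cosh` into a
bound on `cosh` itself. -/
lemma cosh_add_log_two_sub (y : ℝ) :
    Real.cosh (y + Real.log 2) - Real.cosh y = (3 / 2 * Real.exp y - Real.cosh y) / 2 := by
  have h1 : Real.exp (y + Real.log 2) = 2 * Real.exp y := by
    rw [Real.exp_add, Real.exp_log two_pos]; ring
  have h2 : Real.exp (-(y + Real.log 2)) = Real.exp (-y) / 2 := by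
    rw [neg_add, Real.exp_add, Real.exp_neg (Real.log 2), Real.exp_log two_pos]; ring
  rw [Real.cosh_eq, Real.cosh_eq, h1, h2]
  ring

/-- Translating a minimiser by `± ln 2 / τ_N` does not decrease its energy. If it is carried by a
half-line, this bounds its exponential moments in both directions. -/
lemma IsEquilibriumMeasure.integral_cosh_le (h : IsEquilibriumMeasure r α ω₁ ω₂ ε N μ)
    (hμ : FiniteEnergy r α ω₁ ω₂ ε N (μ : Measure ℝ)) (hr : 0 < r)
    (hg : Integrable (gFun ε)) (hN : 0 < N) (hτ : 0 < tau N) {σ ς : ℝ} (hσ : σ = 1 ∨ σ = -1)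
    (hς : ∀ᵐ x ∂(μ : Measure ℝ), σ * x ≤ ς) :
    ∫ x, Real.cosh (tau N * x) ∂(μ : Measure ℝ) ≤
      3 / 2 * Real.exp (tau N * ς) + 2 * ((|α| * Real.log 2 + ∫ y, gFun ε y) / r) := by
  have hNr : (0 : ℝ) < N := Nat.cast_pos.2 hN
  have hcosh := integrable_cosh_of_potential hr α hg hN hτ hμ.potential
  set C := ∫ y, gFun ε y with hC
  set a := σ * Real.log 2 / tau N with ha
  have hσa : |σ| = 1 := by rcases hσ with rfl | rfl <;> simp
  have hshift : Integrable (fun x => Real.cosh (tau N * (x + a))) (μ : Measure ℝ) := by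
    have hsinh : Integrable (fun x => Real.sinh (tau N * x)) (μ : Measure ℝ) :=
      hcosh.mono' (by fun_prop) <| Filter.Eventually.of_forall fun x => by
        rw [Real.norm_eq_abs, abs_le]
        constructor
        · linarith [Real.cosh_add_sinh (tau N * x), Real.exp_pos (tau N * x)]
        · exact (Real.sinh_lt_cosh _).le
    simp only [mul_add, Real.cosh_add]
    exact (hcosh.mul_const _).add (hsinh.mul_const _)
  have hVshift : Integrable (fun x => potential r α ε N (x + a)) (μ : Measure ℝ) := by
    set e : ℝ ≃ᵐ ℝ := MeasurableEquiv.addRight a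
    have : IsProbabilityMeasure ((μ : Measure ℝ).map e) :=
      Measure.isProbabilityMeasure_map e.measurable.aemeasurable
    have h1 : Integrable (fun x => Real.cosh (tau N * x)) ((μ : Measure ℝ).map e) := by
      rw [integrable_map_equiv]; exact hshift
    have h2 := integrable_potential_of_cosh r α hg hN hτ h1
    rw [integrable_map_equiv] at h2
    exact h2
  have hle := h.integral_potential_le_translate hμ a hVshift
  set T := 3 / 2 * Real.exp (tau N * ς) with hT
  have hpt : ∀ᵐ x ∂(μ : Measure ℝ), potential r α ε N (x + a) - potential r α ε N x ≤
      r / (N * tau N) * ((T - Real.cosh (tau N * x)) / 2 + (|α| * Real.log 2 + C) / r) := by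
    filter_upwards [hς] with x hx
    have h1 : Real.cosh (tau N * (x + a)) = Real.cosh (σ * (tau N * x) + Real.log 2) := by
      have h2 : tau N * (x + a) = tau N * x + σ * Real.log 2 := by
        rw [ha]; field_simp
      rw [h2]
      rcases hσ with rfl | rfl
      · simp
      · rw [← Real.cosh_neg]; congr 1; ring
    have h3 : Real.cosh (tau N * x) = Real.cosh (σ * (tau N * x)) := by
      rcases hσ with rfl | rfl
      · simp
      · rw [neg_one_mul, Real.cosh_neg]
    have h4 : Real.cosh (tau N * (x + a)) - Real.cosh (tau N * x)
        ≤ (T - Real.cosh (tau N * x)) / 2 := by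
      rw [h1, h3, cosh_add_log_two_sub, hT]
      have : Real.exp (σ * (tau N * x)) ≤ Real.exp (tau N * ς) :=
        Real.exp_le_exp.2 (by nlinarith)
      linarith
    have h5 := mul_le_mul_of_nonneg_left h4 (by positivity : 0 ≤ r / (N * tau N))
    have h6 : -(α * a / N) ≤ |α| * Real.log 2 / (N * tau N) := by
      have h7 : |α * a / N| = |α| * Real.log 2 / (N * tau N) := by
        rw [ha, abs_div, abs_mul, abs_div, abs_mul, hσa, abs_of_pos hNr, abs_of_pos hτ,
          abs_of_pos (Real.log_pos one_lt_two)]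
        field_simp
      rw [← h7]
      exact neg_le_abs _
    have h8 := smoothing_nonneg ε N (x + a)
    have h9 := smoothing_le hg hN hτ x
    have h10 : r / (N * tau N) * ((|α| * Real.log 2 + C) / r)
        = |α| * Real.log 2 / (N * tau N) + C / (N * tau N) := by
      field_simp
    have h11 : α * (x + a) / N = α * x / N + α * a / N := by ring
    rw [potential_eq, potential_eq, mul_add (r / (N * tau N)), h10, h11]
    linarith
  have hTc : Integrable (fun x => T - Real.cosh (tau N * x)) (μ : Measure ℝ) :=
    (integrable_const T).sub hcosh
  have hTc2 : Integrable (fun x => (T - Real.cosh (tau N * x)) / 2) (μ : Measure ℝ) :=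
    hTc.div_const 2
  have hint := integral_mono_ae (hVshift.sub hμ.potential)
    ((hTc2.add (integrable_const ((|α| * Real.log 2 + C) / r))).const_mul (r / (N * tau N))) hpt
  have hval : ∫ x, r / (N * tau N) * ((T - Real.cosh (tau N * x)) / 2
      + (|α| * Real.log 2 + C) / r) ∂(μ : Measure ℝ) = r / (N * tau N) *
        ((T - ∫ x, Real.cosh (tau N * x) ∂(μ : Measure ℝ)) / 2
          + (|α| * Real.log 2 + C) / r) := by
    rw [integral_const_mul, integral_add hTc2 (integrable_const _), integral_div,
      integral_sub (integrable_const _) hcosh]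
    simp
  have h0 : 0 ≤ r / (N * tau N) * ((T - ∫ x, Real.cosh (tau N * x) ∂(μ : Measure ℝ)) / 2
      + (|α| * Real.log 2 + C) / r) := by
    rw [← hval]
    refine le_trans ?_ hint
    simp only [Pi.sub_apply]
    rw [integral_sub hVshift hμ.potential]
    linarith
  have h1 := nonneg_of_mul_nonneg_right h0 (by positivity)
  linarith

/-- The exponential moment bound leaves mass only at distance `O(ς + 1 / τ_N)` from the origin. -/
lemma integral_abs_le {μ : Measure ℝ} [IsProbabilityMeasure μ] {C₁ ς : ℝ} (hC₁ : 0 ≤ C₁)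
    (hς : 0 ≤ ς) (hτ : 0 < tau N) (hcosh : Integrable (fun x => Real.cosh (tau N * x)) μ)
    (h : ∫ x, Real.cosh (tau N * x) ∂μ ≤ 3 / 2 * Real.exp (tau N * ς) + 2 * C₁) :
    ∫ x, |x| ∂μ ≤ 2 * ς + (3 + 4 * C₁) / tau N := by
  set k := 2 * Real.exp (-(2 * (tau N * ς))) / tau N with hk
  have hk0 : 0 ≤ k := by positivity
  have h1 : ∀ x, |x| ≤ 2 * ς + k * Real.cosh (tau N * x) := by
    intro x
    have h2 : tau N * |x| - 2 * (tau N * ς) ≤ Real.exp (tau N * |x| - 2 * (tau N * ς)) := by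
      linarith [Real.add_one_le_exp (tau N * |x| - 2 * (tau N * ς))]
    have h3 : Real.exp (tau N * |x|) ≤ 2 * Real.cosh (tau N * x) := by
      rw [← Real.cosh_abs (tau N * x), abs_mul, abs_of_pos hτ, Real.cosh_eq]
      linarith [Real.exp_pos (-(tau N * |x|))]
    rw [sub_eq_add_neg (tau N * |x|), Real.exp_add] at h2
    have h4 := mul_le_mul_of_nonneg_right h3 (Real.exp_pos (-(2 * (tau N * ς)))).le
    have h5 : |x| = (tau N * |x|) / tau N := by field_simp
    have h6 : 2 * ς + k * Real.cosh (tau N * x) = (2 * (tau N * ς)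
        + 2 * Real.cosh (tau N * x) * Real.exp (-(2 * (tau N * ς)))) / tau N := by
      rw [hk]; field_simp
    rw [h5, h6]
    exact div_le_div_of_nonneg_right (by linarith) hτ.le
  have h7 : ∫ x, |x| ∂μ ≤ 2 * ς + k * ∫ x, Real.cosh (tau N * x) ∂μ := by
    have h8 := integral_mono (integrable_abs_of_cosh hτ hcosh)
      ((integrable_const (2 * ς)).add (hcosh.const_mul k)) h1
    refine h8.trans_eq ?_
    simp only [Pi.add_apply]
    rw [integral_add (integrable_const _) (hcosh.const_mul k), integral_const, integral_const_mul]
    simp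
  have h9 := mul_le_mul_of_nonneg_left h hk0
  have h10 : k * (3 / 2 * Real.exp (tau N * ς) + 2 * C₁) ≤ (3 + 4 * C₁) / tau N := by
    have h11 : Real.exp (-(2 * (tau N * ς))) * Real.exp (tau N * ς) ≤ 1 := by
      rw [← Real.exp_add, Real.exp_le_one_iff]
      nlinarith
    have h12 : Real.exp (-(2 * (tau N * ς))) ≤ 1 := by
      rw [Real.exp_le_one_iff]
      have : 0 ≤ tau N * ς := by positivity
      linarith
    rw [hk, div_mul_eq_mul_div]
    refine div_le_div_of_nonneg_right ?_ hτ.le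
    nlinarith
  linarith

/-- The energy is bounded below in terms of the first absolute moment, because the interaction grows
at most linearly. -/
lemma le_energyValue {μ : Measure ℝ} [IsProbabilityMeasure μ] (hr : 0 < r)
    (hω₁ : 0 < ω₁) (hω₂ : 0 < ω₂) (hg : Integrable (gFun ε)) (hN : 0 < N) (hτ : 0 < tau N)
    (hμ : FiniteEnergy r α ω₁ ω₂ ε N μ) :
    -((α ^ 2 / r + ∫ y, gFun ε y) / tau N) - Real.pi * (ω₁ + ω₂) * ∫ x, |x| ∂μ
      ≤ energyValue r α ω₁ ω₂ ε N μ := by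
  have hN1 : (1 : ℝ) ≤ N := Nat.one_le_cast.2 hN
  have hpi := Real.pi_pos
  have hxi := integrable_abs_of_cosh hτ
    (integrable_cosh_of_potential hr α hg hN hτ hμ.potential)
  have hK : 0 ≤ α ^ 2 / r + ∫ y, gFun ε y :=
    add_nonneg (by positivity) (integral_nonneg (gFun_nonneg ε))
  have h1 : -((α ^ 2 / r + ∫ y, gFun ε y) / tau N) ≤ ∫ x, potential r α ε N x ∂μ := by
    have h2 : ∫ _x, -((α ^ 2 / r + ∫ y, gFun ε y) / tau N) ∂μ ≤ ∫ x, potential r α ε N x ∂μ := by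
      refine integral_mono (integrable_const _) hμ.potential fun x => ?_
      have h3 := half_cosh_sub_le_potential hr α hg hN hτ x
      have h4 : 0 ≤ r / (2 * N * tau N) * Real.cosh (tau N * x) :=
        mul_nonneg (by positivity) (Real.cosh_pos _).le
      have h5 : (α ^ 2 / r + ∫ y, gFun ε y) / (N * tau N)
          ≤ (α ^ 2 / r + ∫ y, gFun ε y) / tau N :=
        div_le_div_of_nonneg_left hK hτ (by nlinarith)
      simp only
      linarith
    simpa using h2
  have h6 : ∫ p, interaction ω₁ ω₂ N p.1 p.2 ∂(μ.prod μ)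
      ≤ Real.pi * (ω₁ + ω₂) * tau N * (2 * ∫ x, |x| ∂μ) := by
    have i1 : Integrable (fun p : ℝ × ℝ => |p.1|) (μ.prod μ) := hxi.comp_fst μ
    have i2 : Integrable (fun p : ℝ × ℝ => |p.2|) (μ.prod μ) := hxi.comp_snd μ
    calc ∫ p, interaction ω₁ ω₂ N p.1 p.2 ∂(μ.prod μ)
        ≤ ∫ p : ℝ × ℝ, Real.pi * (ω₁ + ω₂) * tau N * (|p.1| + |p.2|) ∂(μ.prod μ) := by
          refine integral_mono hμ.interaction ((i1.add i2).const_mul _) fun p => ?_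
          refine (interaction_le hω₁ hω₂ hτ p.1 p.2).trans ?_
          exact mul_le_mul_of_nonneg_left (abs_sub _ _) (by positivity)
      _ = Real.pi * (ω₁ + ω₂) * tau N * (2 * ∫ x, |x| ∂μ) := by
          rw [integral_const_mul, integral_add i1 i2, integral_fun_fst (fun x : ℝ => |x|),
            integral_fun_snd (fun x : ℝ => |x|)]
          simp only [probReal_univ, one_smul]
          ring
  have h7 := mul_le_mul_of_nonneg_left h6 (by positivity : 0 ≤ 1 / (2 * tau N))
  have h8 : 1 / (2 * tau N) * (Real.pi * (ω₁ + ω₂) * tau N * (2 * ∫ x, |x| ∂μ))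
      = Real.pi * (ω₁ + ω₂) * ∫ x, |x| ∂μ := by
    field_simp
  rw [energyValue]
  linarith

/-- For large `N` a minimiser charges both half-lines beyond a fixed distance from the origin:
otherwise it would lie, up to `O(1 / τ_N)`, too close to the origin for its energy to be below the
one of the uniform measure on `[0, 1]`. -/
lemma exists_forall_not_ae_mul_le (α : ℝ) (hr : 0 < r) (hω₁ : 0 < ω₁) (hω₂ : 0 < ω₂)
    (hg : Integrable (gFun ε)) :
    ∃ ς : ℝ, 0 < ς ∧ ∃ T : ℝ, ∀ N : ℕ, 0 < N → 1 ≤ tau N → T < tau N →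
      ∀ μ : ProbabilityMeasure ℝ, IsEquilibriumMeasure r α ω₁ ω₂ ε N μ →
        ∀ σ : ℝ, (σ = 1 ∨ σ = -1) → ¬ ∀ᵐ x ∂(μ : Measure ℝ), σ * x ≤ ς := by
  set D := ∫ p : ℝ × ℝ, |p.1 - p.2| ∂(uniformMeasure.prod uniformMeasure) with hD
  have hD0 : 0 < D := meanDistance_uniformMeasure_pos
  have hpi := Real.pi_pos
  set κ := Real.pi * (ω₁ + ω₂) with hκ
  have hκ0 : 0 < κ := by positivity
  set C₁ := (|α| * Real.log 2 + ∫ y, gFun ε y) / r with hC₁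
  have hC₁0 : 0 ≤ C₁ := div_nonneg (add_nonneg
    (mul_nonneg (abs_nonneg _) (Real.log_nonneg one_le_two))
    (integral_nonneg (gFun_nonneg ε))) hr.le
  set C₂ := r + |α| + (2 + 1 / (Real.pi * ω₁) + 1 / (Real.pi * ω₂)) / 2
    - ∫ p : ℝ × ℝ, Real.log (p.1 - p.2) ∂(uniformMeasure.prod uniformMeasure) with hC₂
  set C₃ := α ^ 2 / r + ∫ y, gFun ε y with hC₃
  -- The two energy bounds give `κ * D / 2 ≤ 2 * κ * ς + O(1 / τ)`, which fails for `ς = D / 8` as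
  -- soon as the error term is below `κ * D / 4`.
  refine ⟨D / 8, by positivity, (C₂ + C₃ + κ * (3 + 4 * C₁)) / (κ * D / 4), ?_⟩
  intro N hN hτ1 hT μ h σ hσ hς
  have hτ : 0 < tau N := by linarith
  have hU := finiteEnergy_uniformMeasure r α hω₁ hω₂ hg hN hτ1
  have hμ := h.finiteEnergy (ν := ⟨uniformMeasure, inferInstance⟩) hU
  have h1 := (h.energyValue_le hμ uniformMeasure hU).trans
    (energyValue_uniformMeasure_le hr α hω₁ hω₂ hg hN hτ1)
  have h2 := le_energyValue hr hω₁ hω₂ hg hN hτ hμ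
  have h3 := integral_abs_le hC₁0 (by positivity) hτ
    (integrable_cosh_of_potential hr α hg hN hτ hμ.potential)
    (h.integral_cosh_le hμ hr hg hN hτ hσ hς)
  have h4 := mul_le_mul_of_nonneg_left h3 hκ0.le
  rw [div_lt_iff₀ (by positivity)] at hT
  have h5 : (C₂ + C₃ + κ * (3 + 4 * C₁)) / tau N < κ * D / 4 := by
    rw [div_lt_iff₀ hτ]; linarith
  rw [← hC₂, ← hD, ← hκ] at h1
  rw [← hC₃, ← hκ] at h2
  have h6 : (C₂ + C₃ + κ * (3 + 4 * C₁)) / tau N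
      = C₂ / tau N + C₃ / tau N + κ * ((3 + 4 * C₁) / tau N) := by ring
  linarith

end

end LukyanovIntegral

theorem mainTheorem9 (b r α ω₁ ω₂ : ℝ) (hb : 0 < b) (hr : 0 < r) (hω₁ : 0 < ω₁) (hω₂ : 0 < ω₂)
    (ε : ℝ → ℝ) (hε : LukyanovIntegral.IsTBASolution b r ε) :
    ∃ N₀ : ℕ, 0 < N₀ ∧ ∃ ς : ℝ, 0 < ς ∧ ∀ N : ℕ, N₀ ≤ N →
      ∀ μ : MeasureTheory.ProbabilityMeasure ℝ,
        LukyanovIntegral.IsEquilibriumMeasure r α ω₁ ω₂ ε N μ →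
        ∃ aN bN : ℝ,
          IsLeast (μ : MeasureTheory.Measure ℝ).support aN ∧
          IsGreatest (μ : MeasureTheory.Measure ℝ).support bN ∧
          aN ≤ -ς ∧ ς ≤ bN := by
  have hg := hε.integrable_gFun hb hr
  obtain ⟨ς, hς, T, hmain⟩ :=
    LukyanovIntegral.exists_forall_not_ae_mul_le α hr hω₁ hω₂ hg
  obtain ⟨N₀, hN₀⟩ := Filter.eventually_atTop.1 ((Real.tendsto_log_atTop.comp
    tendsto_natCast_atTop_atTop).eventually (Filter.eventually_ge_atTop (max 1 (T + 1))))
  refine ⟨N₀ + 1, Nat.succ_pos _, ς, hς, fun N hN μ h => ?_⟩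
  have hN0 : 0 < N := by omega
  have hτmax : max 1 (T + 1) ≤ LukyanovIntegral.tau N := hN₀ N (by omega)
  have hτ1 : 1 ≤ LukyanovIntegral.tau N := (le_max_left _ _).trans hτmax
  have hτT : T < LukyanovIntegral.tau N := by linarith [(le_max_right 1 (T + 1)).trans hτmax]
  have hμ := h.finiteEnergy (ν := ⟨LukyanovIntegral.uniformMeasure, inferInstance⟩)
    (LukyanovIntegral.finiteEnergy_uniformMeasure r α hω₁ hω₂ hg hN0 hτ1)
  obtain ⟨R, hR⟩ := h.exists_ae_abs_le hμ hr hω₁ hω₂ hg hN0 (by linarith)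
  have hsub : (μ : Measure ℝ).support ⊆ Set.Icc (-R) R :=
    Measure.support_subset_of_isClosed isClosed_Icc (by
      filter_upwards [hR] with x hx using abs_le.1 hx)
  have hcomp : IsCompact (μ : Measure ℝ).support :=
    isCompact_Icc.of_isClosed_subset Measure.isClosed_support hsub
  have hne : (μ : Measure ℝ).support.Nonempty :=
    Measure.nonempty_support (IsProbabilityMeasure.ne_zero _)
  obtain ⟨aN, ha⟩ := hcomp.exists_isLeast hne
  obtain ⟨bN, hbN⟩ := hcomp.exists_isGreatest hne
  refine ⟨aN, bN, ha, hbN, ?_, ?_⟩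
  · by_contra! hlt
    refine hmain N hN0 hτ1 hτT μ h (-1) (Or.inr rfl) ?_
    filter_upwards [Measure.support_mem_ae (μ := (μ : Measure ℝ))] with x hx
    linarith [ha.2 hx]
  · by_contra! hlt
    refine hmain N hN0 hτ1 hτT μ h 1 (Or.inl rfl) ?_
    filter_upwards [Measure.support_mem_ae (μ := (μ : Measure ℝ))] with x hx
    linarith [hbN.2 hx]
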